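/- There is an absolute constant $c>0$ such that the following holds. Let $n\ge 1$ and let $A$ be an $N\times n$ real random matrix whose rows $A_1,\dots,A_N$ are independent isotropic random vectors in $\mathbb{R}^n$, i.e. $\mathbb{E}\,A_iA_i^{T}=I$ for every $i$ (the rows being regarded as column vectors in this formula; they need be neither centered nor identically distributed). Let $m$ be a number such that $\|A_i\|_2\le\sqrt m$ almost surely for all $i$. Then for every $t\ge 0$, with probability at least $1-2n\cdot\exp(-ct^2)$, $$\sqrt N-t\sqrt m\;\le\; s_{\min}(A)\;\le\; s_{\max}(A)\;\le\;\sqrt N+t\sqrt m .$$ Here $s_{\max}(A)=s_1(A)$ and $s_{\min}(A)=s_n(A)$ are the largest and the smallest of the singular values $s_1(A)\ge\dots\ge s_n(A)\ge 0$ of $A$, that is, of the eigenvalues of $\sqrt{A^{T}A}$ counted with multiplicity (so $s_{\min}(A)=0$ if $N<n$). -/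

import Mathlib

open MeasureTheory ProbabilityTheory

namespace RandomMatrix

/-- The largest singular value `s_max(A) = s₁(A)` of a real `N × n` matrix `A`, viewed as a linear
map from `ℓ₂ⁿ` to `ℓ₂ᴺ`. Mathlib lists the singular values (the square roots of the eigenvalues of
`Aᵀ A`, with multiplicity) in non-increasing order, starting from the index `0`. -/
noncomputable def sMax {N n : ℕ} (A : Matrix (Fin N) (Fin n) ℝ) : ℝ :=
  A.toEuclideanLin.singularValues 0

/-- The smallest singular value `s_min(A) = sₙ(A)` of a real `N × n` matrix `A` with `n ≥ 1`:
the last of the `n` singular values, which have the indices `0, …, n - 1`. It is `0` when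
`N < n`. -/
noncomputable def sMin {N n : ℕ} (A : Matrix (Fin N) (Fin n) ℝ) : ℝ :=
  A.toEuclideanLin.singularValues (n - 1)

/-- The `i`-th row of a matrix, as a vector of the Euclidean space `ℝⁿ`. -/
def row {N n : ℕ} (A : Matrix (Fin N) (Fin n) ℝ) (i : Fin N) : EuclideanSpace ℝ (Fin n) :=
  WithLp.toLp 2 (A i)

/-- The second moment matrix `Σ(X) = 𝔼 X Xᵀ` of a random vector `X` in `ℝⁿ`, entry by entry. -/
noncomputable def secondMomentMatrix {Ω : Type*} [MeasurableSpace Ω] {n : ℕ}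
    (X : Ω → EuclideanSpace ℝ (Fin n)) (μ : Measure Ω) : Matrix (Fin n) (Fin n) ℝ :=
  Matrix.of fun j k => ∫ ω, X ω j * X ω k ∂μ

/-- A random vector `X` in `ℝⁿ` is isotropic if its second moments exist and `Σ(X) = I`. -/
def IsIsotropic {Ω : Type*} [MeasurableSpace Ω] {n : ℕ}
    (X : Ω → EuclideanSpace ℝ (Fin n)) (μ : Measure Ω) : Prop :=
  MemLp X 2 μ ∧ secondMomentMatrix X μ = 1

end RandomMatrix

open Matrix

namespace RandomMatrix

/-! This is a matrix Laplace transform argument in which `tr (1 + τ S) ^ (k + 1)`, with `τ = θ / (k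
+ 1)` and `S = ∑ yᵢ yᵢᵀ`, stands in for `tr exp (θ S)`. The sign of `θ` selects the tail, so one
argument serves both.

The core is `trace_pow_rank_one_update_le`. Along `M + s τ v vᵀ` the trace has derivative `(k + 1) τ
h`, where `h = vᵀ M_s ^ k v`. The derivative of `h` is a sum of products of two such forms with
total degree `k - 1`, which Chebyshev's inequality and `M_s ≥ a` bound by a multiple of `h`.
Grönwall then bounds the increment by a multiple of `vᵀ M ^ k v` at `s = 0`. There `M` is
independent of the isotropic row `v`, so the expected form is `𝔼 tr M ^ k`, and `τ tr M ^ k ≤ τ tr M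
^ (k + 1)` closes the recursion: each row costs a scalar factor.

Markov's inequality and `k → ∞` give `P ≤ n exp (N (e ^ (θ m) - 1) / m - θ L)`. Taking `L = N r ²`,
`θ = 2 log r / m` and `r = 1 ± t √(m / N)` yields each tail with `c = 1`. -/

/-- Chebyshev's sum inequality for the powers of a nonnegative sequence. -/
theorem sum_mul_pow_mul_sum_mul_pow_le {ι : Type*} [Fintype ι] {w x : ι → ℝ} (hw : ∀ i, 0 ≤ w i) (hx : ∀ i, 0 ≤ x i)
    (j l : ℕ) :
    (∑ i, w i * x i ^ j) * (∑ i, w i * x i ^ l) ≤ (∑ i, w i) * ∑ i, w i * x i ^ (j + l) := by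
  have h : 0 ≤ ∑ a, ∑ b, w a * w b * ((x a ^ j - x b ^ j) * (x a ^ l - x b ^ l)) := by
    refine Finset.sum_nonneg fun a _ => Finset.sum_nonneg fun b _ =>
      mul_nonneg (mul_nonneg (hw a) (hw b)) ?_
    rcases le_total (x a) (x b) with h | h
    · exact mul_nonneg_of_nonpos_of_nonpos (sub_nonpos.2 (pow_le_pow_left₀ (hx a) h j))
        (sub_nonpos.2 (pow_le_pow_left₀ (hx a) h l))
    · exact mul_nonneg (sub_nonneg.2 (pow_le_pow_left₀ (hx b) h j))
        (sub_nonneg.2 (pow_le_pow_left₀ (hx b) h l))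
  have e : ∑ a, ∑ b, w a * w b * ((x a ^ j - x b ^ j) * (x a ^ l - x b ^ l)) =
      2 * ((∑ i, w i) * ∑ i, w i * x i ^ (j + l)) -
        2 * ((∑ i, w i * x i ^ j) * (∑ i, w i * x i ^ l)) := by
    have e1 : ∀ a b, w a * w b * ((x a ^ j - x b ^ j) * (x a ^ l - x b ^ l)) =
        w a * x a ^ (j + l) * w b + w a * (w b * x b ^ (j + l)) -
          (w a * x a ^ j) * (w b * x b ^ l) - (w a * x a ^ l) * (w b * x b ^ j) := by
      intro a b; ring
    simp only [e1, Finset.sum_sub_distrib, Finset.sum_add_distrib, ← Finset.mul_sum,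
      ← Finset.sum_mul]
    ring
  linarith

/-! ### Spectral calculus and rank-one updates -/

section Deterministic

variable {ι : Type*} [Fintype ι] [DecidableEq ι]

theorem exists_orthogonal_diagonalization {M : Matrix ι ι ℝ} (hM : M.IsHermitian) :
    ∃ U : Matrix ι ι ℝ, Uᵀ * U = 1 ∧ U * Uᵀ = 1 ∧
      ∀ k : ℕ, M ^ k = U * diagonal (fun i => hM.eigenvalues i ^ k) * Uᵀ := by
  have hU := hM.eigenvectorUnitary.2
  rw [Matrix.mem_unitaryGroup_iff] at hU
  have hU' := (Matrix.mem_unitaryGroup_iff').1 hM.eigenvectorUnitary.2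
  simp only [star_eq_conjTranspose, conjTranspose_eq_transpose_of_trivial] at hU hU'
  refine ⟨hM.eigenvectorUnitary, hU', hU, fun k => ?_⟩
  have h1 : M = (hM.eigenvectorUnitary : Matrix ι ι ℝ) * diagonal hM.eigenvalues *
      (hM.eigenvectorUnitary : Matrix ι ι ℝ)ᵀ := by
    have := hM.spectral_theorem
    rw [Unitary.conjStarAlgAut_apply] at this
    simpa [star_eq_conjTranspose, conjTranspose_eq_transpose_of_trivial, Function.comp_def] using this
  induction k with
  | zero => simp [hU]
  | succ k ih =>
    rw [pow_succ, ih]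
    nth_rewrite 4 [h1]
    have : ∀ U D E : Matrix ι ι ℝ, Uᵀ * U = 1 →
        U * D * Uᵀ * (U * E * Uᵀ) = U * (D * E) * Uᵀ := by
      intro U D E h
      calc U * D * Uᵀ * (U * E * Uᵀ) = U * D * (Uᵀ * U) * E * Uᵀ := by simp only [Matrix.mul_assoc]
        _ = _ := by rw [h]; simp only [Matrix.mul_assoc, Matrix.one_mul]
    rw [this _ _ _ hU', diagonal_mul_diagonal]
    simp only [pow_succ]

theorem trace_pow_eq_sum_eigenvalues {M : Matrix ι ι ℝ} (hM : M.IsHermitian) (k : ℕ) :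
    (M ^ k).trace = ∑ i, hM.eigenvalues i ^ k := by
  obtain ⟨U, h, -, hk⟩ := exists_orthogonal_diagonalization hM
  rw [hk, trace_mul_comm, ← Matrix.mul_assoc, h, Matrix.one_mul, trace_diagonal]

/-- The weights are the squared coordinates of `v` in an eigenbasis. One weight vector serves all
`k`, so forms in different powers can be compared by Chebyshev's inequality. -/
theorem exists_spectral_weights {M : Matrix ι ι ℝ} (hM : M.IsHermitian) (v : ι → ℝ) :
    ∃ w : ι → ℝ, (∀ i, 0 ≤ w i) ∧ ∑ i, w i = v ⬝ᵥ v ∧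
      ∀ k : ℕ, v ⬝ᵥ (M ^ k *ᵥ v) = ∑ i, w i * hM.eigenvalues i ^ k := by
  obtain ⟨U, -, h, hk⟩ := exists_orthogonal_diagonalization hM
  have key : ∀ k : ℕ, v ⬝ᵥ (M ^ k *ᵥ v) = ∑ i, (Uᵀ *ᵥ v) i ^ 2 * hM.eigenvalues i ^ k := by
    intro k
    rw [hk, ← mulVec_mulVec, ← mulVec_mulVec, dotProduct_mulVec, ← mulVec_transpose]
    simp only [dotProduct, mulVec_diagonal]
    exact Finset.sum_congr rfl fun i _ => by ring
  refine ⟨fun i => (Uᵀ *ᵥ v) i ^ 2, fun i => sq_nonneg _, ?_, key⟩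
  simpa using (key 0).symm

theorem eigenvalues_eq_dotProduct {M : Matrix ι ι ℝ} (hM : M.IsHermitian) (i : ι) :
    ∃ x : ι → ℝ, x ⬝ᵥ x = 1 ∧ hM.eigenvalues i = x ⬝ᵥ (M *ᵥ x) := by
  have h1 : (⇑(hM.eigenvectorBasis i) : ι → ℝ) ⬝ᵥ ⇑(hM.eigenvectorBasis i) = 1 := by
    have := hM.eigenvectorBasis.orthonormal.1 i
    rw [EuclideanSpace.norm_eq, Real.sqrt_eq_one] at this
    simpa [dotProduct, sq] using this
  refine ⟨_, h1, ?_⟩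
  rw [hM.mulVec_eigenvectorBasis, dotProduct_smul, h1]
  simp

/-- `0 ≤ S ≤ B` in the sense of quadratic forms. -/
structure IsBetween (S : Matrix ι ι ℝ) (B : ℝ) : Prop where
  isHermitian : S.IsHermitian
  nonneg : ∀ x : ι → ℝ, 0 ≤ x ⬝ᵥ (S *ᵥ x)
  le : ∀ x : ι → ℝ, x ⬝ᵥ (S *ᵥ x) ≤ B * (x ⬝ᵥ x)

theorem IsBetween.isHermitian_one_add_smul {S : Matrix ι ι ℝ} {B : ℝ} (hS : IsBetween S B)
    (τ : ℝ) : (1 + τ • S).IsHermitian := by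
  refine isHermitian_one.add ?_
  have := hS.isHermitian
  rw [IsHermitian, conjTranspose_eq_transpose_of_trivial] at this ⊢
  rw [transpose_smul, this]

theorem IsBetween.eigenvalues_one_add_smul {S : Matrix ι ι ℝ} {B τ a : ℝ} (hS : IsBetween S B)
    (ha1 : a ≤ 1) (haB : a ≤ 1 + τ * B) (i : ι) :
    a ≤ (hS.isHermitian_one_add_smul τ).eigenvalues i ∧
      0 ≤ τ * ((hS.isHermitian_one_add_smul τ).eigenvalues i - 1) := by
  obtain ⟨x, hx, he⟩ := eigenvalues_eq_dotProduct (hS.isHermitian_one_add_smul τ) i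
  have h0 := hS.nonneg x
  have h1 := hS.le x
  rw [he, add_mulVec, one_mulVec, smul_mulVec, dotProduct_add, dotProduct_smul, hx, smul_eq_mul]
  rw [hx, mul_one] at h1
  constructor
  -- For `τ ≥ 0` the floor comes from `S ≥ 0` and `a ≤ 1`; for `τ ≤ 0` from `S ≤ B`.
  · rcases le_total 0 τ with h | h
    · nlinarith
    · nlinarith
  · nlinarith [mul_nonneg (mul_self_nonneg τ) h0]

theorem hasDerivAt_pow_one_add_smul (M D : Matrix ι ι ℝ) (k : ℕ) (s : ℝ) (p q : ι) :
    HasDerivAt (fun s : ℝ => ((M + s • D) ^ k) p q)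
      ((∑ j ∈ Finset.range k, (M + s • D) ^ j * D * (M + s • D) ^ (k - 1 - j)) p q) s := by
  induction k generalizing p q with
  | zero => simpa using hasDerivAt_const s ((1 : Matrix ι ι ℝ) p q)
  | succ k ih =>
    have hD : ∀ r, HasDerivAt (fun s : ℝ => (M + s • D) r q) (D r q) s := by
      intro r
      simpa using ((hasDerivAt_id s).mul_const (D r q)).const_add (M r q)
    have h := HasDerivAt.fun_sum (u := Finset.univ) fun r (_ : r ∈ Finset.univ) =>
      (ih p r).mul (hD r)
    have e : (fun s : ℝ => ((M + s • D) ^ (k + 1)) p q) =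
        fun s : ℝ => ∑ r, ((M + s • D) ^ k) p r * (M + s • D) r q := by
      ext s
      rw [pow_succ, Matrix.mul_apply]
    rw [e]
    refine h.congr_deriv ?_
    rw [Finset.sum_add_distrib, ← Matrix.mul_apply, ← Matrix.mul_apply, ← Matrix.add_apply]
    refine congrFun (congrFun ?_ p) q
    rw [Finset.sum_range_succ, Finset.sum_mul]
    congr 1
    · refine Finset.sum_congr rfl fun j hj => ?_
      have : k + 1 - 1 - j = (k - 1 - j) + 1 := by
        have := Finset.mem_range.1 hj; omega
      rw [this, pow_succ]
      simp only [Matrix.mul_assoc]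
    · simp

/-- Cyclicity of the trace makes the `k + 1` terms of the product rule equal. -/
theorem hasDerivAt_trace_pow (M : Matrix ι ι ℝ) (v : ι → ℝ) (τ : ℝ) (k : ℕ) (s : ℝ) :
    HasDerivAt (fun s : ℝ => ((M + s • τ • vecMulVec v v) ^ (k + 1)).trace)
      ((k + 1) * (τ * (v ⬝ᵥ ((M + s • τ • vecMulVec v v) ^ k *ᵥ v)))) s := by
  have h := HasDerivAt.fun_sum (u := Finset.univ) fun r (_ : r ∈ Finset.univ) =>
    hasDerivAt_pow_one_add_smul M (τ • vecMulVec v v) (k + 1) s r r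
  refine h.congr_deriv ?_
  change Matrix.trace (∑ j ∈ Finset.range (k + 1), _) = _
  rw [trace_sum]
  have : ∀ j ∈ Finset.range (k + 1), ((M + s • τ • vecMulVec v v) ^ j * τ • vecMulVec v v *
      (M + s • τ • vecMulVec v v) ^ (k + 1 - 1 - j)).trace =
      τ * (v ⬝ᵥ ((M + s • τ • vecMulVec v v) ^ k *ᵥ v)) := by
    intro j hj
    have hj' : k + 1 - 1 - j + j = k := by have := Finset.mem_range.1 hj; omega
    rw [trace_mul_comm, ← Matrix.mul_assoc, ← pow_add, hj', Matrix.mul_smul, trace_smul,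
      mul_vecMulVec, trace_vecMulVec, smul_eq_mul, dotProduct_comm]
  rw [Finset.sum_congr rfl this]
  simp

/-- Since the direction `v vᵀ` has rank one, each term of the product rule splits into a product of
two quadratic forms. -/
theorem hasDerivAt_dotProduct_pow (M : Matrix ι ι ℝ) (v : ι → ℝ) (τ : ℝ) (k : ℕ) (s : ℝ) :
    HasDerivAt (fun s : ℝ => v ⬝ᵥ ((M + s • τ • vecMulVec v v) ^ k *ᵥ v))
      (τ * ∑ j ∈ Finset.range k, (v ⬝ᵥ ((M + s • τ • vecMulVec v v) ^ j *ᵥ v)) *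
        (v ⬝ᵥ ((M + s • τ • vecMulVec v v) ^ (k - 1 - j) *ᵥ v))) s := by
  have h := HasDerivAt.fun_sum (u := Finset.univ) fun p (_ : p ∈ Finset.univ) =>
    (HasDerivAt.fun_sum (u := Finset.univ) fun q (_ : q ∈ Finset.univ) =>
      (hasDerivAt_pow_one_add_smul M (τ • vecMulVec v v) k s p q).mul_const (v q)).const_mul (v p)
  refine h.congr_deriv ?_
  change v ⬝ᵥ ((∑ j ∈ Finset.range k, _) *ᵥ v) = _
  rw [sum_mulVec, dotProduct_sum, Finset.mul_sum]
  refine Finset.sum_congr rfl fun j _ => ?_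
  rw [Matrix.mul_smul, Matrix.smul_mul, smul_mulVec, dotProduct_smul, smul_eq_mul,
    ← mulVec_mulVec, ← mulVec_mulVec, vecMulVec_mulVec]
  simp [mulVec_smul, dotProduct_smul, mul_comm]

/-- Grönwall for `τ h`, followed by integration of `exp (c s)` over `[0, 1]`. Keeping the factor `τ`
attached to `h` covers both signs at once. -/
theorem le_add_of_deriv_le {g h h' : ℝ → ℝ} {κ τ c : ℝ} (hκ : 0 ≤ κ) (hc : c ≠ 0)
    (hg : ∀ s, HasDerivAt g (κ * (τ * h s)) s) (hh : ∀ s, HasDerivAt h (h' s) s)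
    (hle : ∀ s ∈ Set.Icc (0 : ℝ) 1, τ * h' s ≤ c * (τ * h s)) :
    g 1 ≤ g 0 + τ * (κ * ((Real.exp c - 1) / c)) * h 0 := by
  have hexp : ∀ b s : ℝ, HasDerivAt (fun s => Real.exp (b * s)) (Real.exp (b * s) * b) s := by
    intro b s
    simpa using ((hasDerivAt_id s).const_mul b).exp
  have hu : ∀ s, HasDerivAt (fun s => τ * h s * Real.exp (-c * s))
      (τ * h' s * Real.exp (-c * s) + τ * h s * (Real.exp (-c * s) * -c)) s := fun s =>
    ((hh s).const_mul τ).mul (hexp (-c) s)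
  have anti1 : AntitoneOn (fun s => τ * h s * Real.exp (-c * s)) (Set.Icc 0 1) := by
    refine antitoneOn_of_deriv_nonpos (convex_Icc 0 1)
      (fun s _ => (hu s).continuousAt.continuousWithinAt)
      (fun s _ => (hu s).differentiableAt.differentiableWithinAt) fun s hs => ?_
    rw [(hu s).deriv]
    have := hle s (interior_subset hs)
    nlinarith [Real.exp_pos (-c * s)]
  have hbound : ∀ s ∈ Set.Icc (0 : ℝ) 1, τ * h s ≤ τ * h 0 * Real.exp (c * s) := by
    intro s hs
    have := anti1 (Set.left_mem_Icc.2 zero_le_one) hs hs.1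
    simp only [mul_zero, Real.exp_zero, mul_one] at this
    have h2 := mul_le_mul_of_nonneg_right this (Real.exp_pos (c * s)).le
    rwa [mul_assoc (τ * h s), ← Real.exp_add, neg_mul, neg_add_cancel, Real.exp_zero, mul_one] at h2
  have hG : ∀ s, HasDerivAt (fun s => g s - κ * (τ * h 0) * (Real.exp (c * s) / c))
      (κ * (τ * h s) - κ * (τ * h 0) * (Real.exp (c * s) * c / c)) s := fun s =>
    (hg s).sub (((hexp c s).div_const c).const_mul _)
  have anti2 : AntitoneOn (fun s => g s - κ * (τ * h 0) * (Real.exp (c * s) / c))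
      (Set.Icc 0 1) := by
    refine antitoneOn_of_deriv_nonpos (convex_Icc 0 1)
      (fun s _ => (hG s).continuousAt.continuousWithinAt)
      (fun s _ => (hG s).differentiableAt.differentiableWithinAt) fun s hs => ?_
    rw [(hG s).deriv, mul_div_cancel_right₀ _ hc]
    nlinarith [hbound s (interior_subset hs)]
  have := anti2 (Set.left_mem_Icc.2 zero_le_one) (Set.right_mem_Icc.2 zero_le_one) zero_le_one
  simp only [mul_zero, mul_one, Real.exp_zero] at this
  have e : τ * (κ * ((Real.exp c - 1) / c)) * h 0 =
      κ * (τ * h 0) * (Real.exp c / c) - κ * (τ * h 0) * (1 / c) := by ring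
  linarith

/-- How the trace of a power of `1 + τ S` changes under a rank-one update of `S`. -/
theorem trace_pow_rank_one_update_le {S : Matrix ι ι ℝ} {v : ι → ℝ} {B τ a m : ℝ}
    (hS : IsBetween S B) (hSv : IsBetween (S + vecMulVec v v) B) (ha : 0 < a) (ha1 : a ≤ 1)
    (haB : a ≤ 1 + τ * B) (hm : 0 < m) (hv : v ⬝ᵥ v ≤ m) (hτ : τ ≠ 0) (k : ℕ) :
    ((1 + τ • (S + vecMulVec v v)) ^ (k + 1)).trace ≤ ((1 + τ • S) ^ (k + 1)).trace +
      τ * ((k + 1) * ((Real.exp ((k + 1) * τ * m / a) - 1) / ((k + 1) * τ * m / a))) *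
        (v ⬝ᵥ ((1 + τ • S) ^ k *ᵥ v)) := by
  have hk : (0 : ℝ) < k + 1 := by positivity
  have hc : ((k : ℝ) + 1) * τ * m / a ≠ 0 := by
    have := hk.ne'; have := hm.ne'; have := ha.ne'; positivity
  have key := le_add_of_deriv_le (κ := k + 1) (τ := τ) (c := (k + 1) * τ * m / a) hk.le hc
    (hasDerivAt_trace_pow (1 + τ • S) v τ k) (hasDerivAt_dotProduct_pow (1 + τ • S) v τ k) ?_
  · simpa [smul_add, add_assoc] using key
  intro s hs
  -- The bounds are convex in the matrix, so they hold on the whole segment.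
  have hSs : IsBetween (S + s • vecMulVec v v) B := by
    have e : S + s • vecMulVec v v = (1 - s) • S + s • (S + vecMulVec v v) := by
      ext; simp; ring
    have h1 : 0 ≤ 1 - s := by linarith [hs.2]
    refine ⟨?_, fun x => ?_, fun x => ?_⟩
    · have h1 := hS.isHermitian
      have h2 := hSv.isHermitian
      rw [IsHermitian, conjTranspose_eq_transpose_of_trivial] at h1 h2 ⊢
      rw [e, transpose_add, transpose_smul, transpose_smul, h1, h2]
    · rw [e, add_mulVec, smul_mulVec, smul_mulVec, dotProduct_add, dotProduct_smul,
        dotProduct_smul]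
      exact add_nonneg (mul_nonneg h1 (hS.nonneg x)) (mul_nonneg hs.1 (hSv.nonneg x))
    · rw [e, add_mulVec, smul_mulVec, smul_mulVec, dotProduct_add, dotProduct_smul,
        dotProduct_smul, smul_eq_mul, smul_eq_mul]
      nlinarith [mul_le_mul_of_nonneg_left (hS.le x) h1, mul_le_mul_of_nonneg_left (hSv.le x) hs.1]
  have eM : 1 + τ • S + s • τ • vecMulVec v v = 1 + τ • (S + s • vecMulVec v v) := by
    rw [smul_add, add_assoc, smul_comm]
  rw [eM]
  have hM := hSs.isHermitian_one_add_smul τ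
  have hev := fun i => (hSs.eigenvalues_one_add_smul ha1 haB i).1
  obtain ⟨w, hw, hws, hwk⟩ := exists_spectral_weights hM v
  simp only [hwk]
  have hev0 : ∀ i, 0 ≤ hM.eigenvalues i := fun i => ha.le.trans (hev i)
  have hq : ∀ j, 0 ≤ ∑ i, w i * hM.eigenvalues i ^ j := fun j =>
    Finset.sum_nonneg fun i _ => mul_nonneg (hw i) (pow_nonneg (hev0 i) j)
  have hsum : ∑ j ∈ Finset.range k, (∑ i, w i * hM.eigenvalues i ^ j) *
      (∑ i, w i * hM.eigenvalues i ^ (k - 1 - j)) ≤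
      (k + 1) * (m / a) * ∑ i, w i * hM.eigenvalues i ^ k := by
    have hterm : ∀ j ∈ Finset.range k, (∑ i, w i * hM.eigenvalues i ^ j) *
        (∑ i, w i * hM.eigenvalues i ^ (k - 1 - j)) ≤
        m / a * ∑ i, w i * hM.eigenvalues i ^ k := by
      intro j hj
      have hj' := Finset.mem_range.1 hj
      have e1 : j + (k - 1 - j) = k - 1 := by omega
      have e2 : k = k - 1 + 1 := by omega
      refine (sum_mul_pow_mul_sum_mul_pow_le hw hev0 _ _).trans ?_
      rw [e1, hws]
      -- The missing power is recovered at the price `1 / a`, as every eigenvalue is at least `a`.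
      have h3 : ∑ i, w i * hM.eigenvalues i ^ (k - 1) ≤
          (∑ i, w i * hM.eigenvalues i ^ k) / a := by
        rw [le_div_iff₀ ha, Finset.sum_mul]
        refine Finset.sum_le_sum fun i _ => ?_
        conv_rhs => rw [e2, pow_succ]
        rw [mul_assoc]
        exact mul_le_mul_of_nonneg_left
          (mul_le_mul_of_nonneg_left (hev i) (pow_nonneg (hev0 i) _)) (hw i)
      calc _ ≤ m * ((∑ i, w i * hM.eigenvalues i ^ k) / a) :=
            mul_le_mul hv h3 (hq _) hm.le
        _ = _ := by ring
    refine (Finset.sum_le_sum hterm).trans ?_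
    rw [Finset.sum_const, Finset.card_range, nsmul_eq_mul, ← mul_assoc]
    have : 0 ≤ m / a := by positivity
    -- Relaxing `k` to `k + 1` makes the Grönwall rate exactly `θ m / a` when `τ = θ / (k + 1)`.
    exact mul_le_mul_of_nonneg_right (by nlinarith) (hq k)
  calc τ * (τ * _) = τ ^ 2 * _ := by rw [← mul_assoc, ← sq]
    _ ≤ τ ^ 2 * _ := mul_le_mul_of_nonneg_left hsum (sq_nonneg τ)
    _ = _ := by ring

/-- Each eigenvalue minus `1` has the sign of `τ`, because `S ≥ 0`. -/
theorem IsBetween.mul_trace_pow_le {S : Matrix ι ι ℝ} {B τ a : ℝ} (hS : IsBetween S B)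
    (ha : 0 < a) (ha1 : a ≤ 1) (haB : a ≤ 1 + τ * B) (k : ℕ) :
    τ * ((1 + τ • S) ^ k).trace ≤ τ * ((1 + τ • S) ^ (k + 1)).trace := by
  have hev := hS.eigenvalues_one_add_smul ha1 haB
  rw [trace_pow_eq_sum_eigenvalues (hS.isHermitian_one_add_smul τ),
    trace_pow_eq_sum_eigenvalues (hS.isHermitian_one_add_smul τ), Finset.mul_sum, Finset.mul_sum]
  refine Finset.sum_le_sum fun i _ => ?_
  have := mul_nonneg (pow_nonneg (ha.le.trans (hev i).1) k) (hev i).2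
  rw [pow_succ]
  linarith

theorem IsBetween.trace_pow_nonneg {S : Matrix ι ι ℝ} {B τ a : ℝ} (hS : IsBetween S B)
    (ha : 0 < a) (ha1 : a ≤ 1) (haB : a ≤ 1 + τ * B) (k : ℕ) :
    0 ≤ ((1 + τ • S) ^ k).trace := by
  rw [trace_pow_eq_sum_eigenvalues (hS.isHermitian_one_add_smul τ)]
  exact Finset.sum_nonneg fun i _ =>
    pow_nonneg (ha.le.trans (hS.eigenvalues_one_add_smul ha1 haB i).1) k

/-- In the eigenbasis each spectral weight of `x` is at most `x ⬝ᵥ x`, so the form at `x` is at most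
the trace times `x ⬝ᵥ x`. -/
theorem IsBetween.pow_le_trace_pow {S : Matrix ι ι ℝ} {B τ a : ℝ} (hS : IsBetween S B)
    (ha : 0 < a) (ha1 : a ≤ 1) (haB : a ≤ 1 + τ * B) (k : ℕ) {x : ι → ℝ} {l : ℝ}
    (hx : x ≠ 0) (hl : S *ᵥ x = l • x) :
    (1 + τ * l) ^ k ≤ ((1 + τ • S) ^ k).trace := by
  have hev := hS.eigenvalues_one_add_smul ha1 haB
  obtain ⟨w, hw, hws, hwk⟩ := exists_spectral_weights (hS.isHermitian_one_add_smul τ) x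
  have hxx : 0 < x ⬝ᵥ x := by
    have h0 : 0 ≤ x ⬝ᵥ x := Finset.sum_nonneg fun i _ => mul_self_nonneg (x i)
    exact lt_of_le_of_ne h0 fun h => hx (dotProduct_self_eq_zero.1 h.symm)
  have hpow : (1 + τ • S) ^ k *ᵥ x = (1 + τ * l) ^ k • x := by
    induction k with
    | zero => simp
    | succ k ih =>
      rw [pow_succ, ← mulVec_mulVec, add_mulVec, one_mulVec, smul_mulVec, hl, smul_smul]
      have : x + (τ * l) • x = (1 + τ * l) • x := by rw [add_smul, one_smul]
      rw [this, mulVec_smul, ih, smul_smul, pow_succ, mul_comm]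
  have h1 := hwk k
  rw [hpow, dotProduct_smul, smul_eq_mul] at h1
  rw [trace_pow_eq_sum_eigenvalues (hS.isHermitian_one_add_smul τ)]
  refine le_of_mul_le_mul_right ?_ hxx
  rw [h1, Finset.sum_mul]
  refine Finset.sum_le_sum fun i _ => ?_
  rw [mul_comm]
  refine mul_le_mul_of_nonneg_left ?_ (pow_nonneg (ha.le.trans (hev i).1) k)
  rw [← hws]
  exact Finset.single_le_sum (fun j _ => hw j) (Finset.mem_univ i)

end Deterministic

/-! ### Gram matrices -/

/-- The partial Gram matrix `∑ i ∈ s, yᵢ yᵢᵀ`. -/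
def gram {κ : Type*} {n : ℕ} (y : κ → EuclideanSpace ℝ (Fin n)) (s : Finset κ) :
    Matrix (Fin n) (Fin n) ℝ :=
  ∑ i ∈ s, vecMulVec (y i).ofLp (y i).ofLp

theorem dotProduct_gram_mulVec {κ : Type*} {n : ℕ} (y : κ → EuclideanSpace ℝ (Fin n))
    (s : Finset κ) (x : Fin n → ℝ) :
    x ⬝ᵥ (gram y s *ᵥ x) = ∑ i ∈ s, ((y i).ofLp ⬝ᵥ x) ^ 2 := by
  rw [gram, sum_mulVec, dotProduct_sum]
  refine Finset.sum_congr rfl fun i _ => ?_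
  rw [vecMulVec_mulVec]
  simp [sq, dotProduct_comm x]

theorem dotProduct_self_eq_norm_sq {n : ℕ} (x : EuclideanSpace ℝ (Fin n)) :
    x.ofLp ⬝ᵥ x.ofLp = ‖x‖ ^ 2 := by
  rw [EuclideanSpace.norm_sq_eq]
  simp [dotProduct, sq]

theorem isBetween_gram {κ : Type*} {n : ℕ} {y : κ → EuclideanSpace ℝ (Fin n)} {s : Finset κ}
    {m B : ℝ} (hy : ∀ i ∈ s, (y i).ofLp ⬝ᵥ (y i).ofLp ≤ m) (hB : s.card * m ≤ B) :
    IsBetween (gram y s) B := by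
  refine ⟨?_, fun x => ?_, fun x => ?_⟩
  · rw [IsHermitian, conjTranspose_eq_transpose_of_trivial, gram, transpose_sum]
    simp only [transpose_vecMulVec]
  · rw [dotProduct_gram_mulVec]
    exact Finset.sum_nonneg fun i _ => sq_nonneg _
  · have hx : 0 ≤ x ⬝ᵥ x := Finset.sum_nonneg fun i _ => mul_self_nonneg (x i)
    rw [dotProduct_gram_mulVec]
    calc ∑ i ∈ s, ((y i).ofLp ⬝ᵥ x) ^ 2 ≤ ∑ i ∈ s, m * (x ⬝ᵥ x) := by
          refine Finset.sum_le_sum fun i hi => ?_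
          refine le_trans ?_ (mul_le_mul_of_nonneg_right (hy i hi) hx)
          simpa [dotProduct, sq] using
            Finset.sum_mul_sq_le_sq_mul_sq Finset.univ (y i).ofLp x
      _ = s.card * m * (x ⬝ᵥ x) := by rw [Finset.sum_const, nsmul_eq_mul]; ring
      _ ≤ B * (x ⬝ᵥ x) := mul_le_mul_of_nonneg_right hB hx

theorem gram_insert {κ : Type*} [DecidableEq κ] {n : ℕ} (y : κ → EuclideanSpace ℝ (Fin n))
    {s : Finset κ} {i : κ} (hi : i ∉ s) :
    gram y (insert i s) = gram y s + vecMulVec (y i).ofLp (y i).ofLp := by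
  rw [gram, Finset.sum_insert hi, add_comm]
  rfl

theorem continuous_pow_one_add_gram {κ : Type*} [Fintype κ] {n : ℕ} (τ : ℝ) (k : ℕ)
    (p q : Fin n) :
    Continuous fun y : κ → EuclideanSpace ℝ (Fin n) =>
      ((1 + τ • gram y Finset.univ) ^ k) p q := by
  have h : Continuous fun y : κ → EuclideanSpace ℝ (Fin n) =>
      (1 + τ • gram y Finset.univ) ^ k := by
    refine Continuous.pow (continuous_const.add (Continuous.const_smul ?_ τ)) k
    refine continuous_finsetSum _ fun i _ => ?_
    exact Continuous.matrix_vecMulVec (by fun_prop) (by fun_prop)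
  exact h.matrix_elem p q

/-! ### Expected traces of powers -/

section Probability

variable {Ω : Type*} [MeasurableSpace Ω] {μ : Measure Ω}

theorem memLp_top_matrix_pow [IsFiniteMeasure μ] {n : ℕ} {M : Ω → Matrix (Fin n) (Fin n) ℝ}
    (hM : ∀ p q, MemLp (fun ω => M ω p q) ⊤ μ) (k : ℕ) (p q : Fin n) :
    MemLp (fun ω => (M ω ^ k) p q) ⊤ μ := by
  induction k generalizing q with
  | zero => simpa using memLp_const _
  | succ k ih =>
    simp only [pow_succ, Matrix.mul_apply]
    exact memLp_finsetSum _ fun r _ => (hM r q).mul' (ih r)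

variable {κ : Type*} {n : ℕ} {X : κ → Ω → EuclideanSpace ℝ (Fin n)} {m : ℝ}

theorem memLp_top_coord (hX : ∀ i, Measurable (X i))
    (hb : ∀ i, ∀ᵐ ω ∂μ, (X i ω).ofLp ⬝ᵥ (X i ω).ofLp ≤ m) (i : κ) (p : Fin n) :
    MemLp (fun ω => X i ω p) ⊤ μ := by
  refine memLp_top_of_bound (C := √m) ?_ ?_
  · exact ((by fun_prop : Measurable fun x : EuclideanSpace ℝ (Fin n) => x p).comp
      (hX i)).aestronglyMeasurable
  · filter_upwards [hb i] with ω h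
    refine Real.abs_le_sqrt (le_trans ?_ h)
    rw [sq]
    exact Finset.single_le_sum (f := fun p => X i ω p * X i ω p)
      (fun p _ => mul_self_nonneg _) (Finset.mem_univ p)

theorem memLp_top_pow_one_add_gram [IsFiniteMeasure μ] (hX : ∀ i, Measurable (X i))
    (hb : ∀ i, ∀ᵐ ω ∂μ, (X i ω).ofLp ⬝ᵥ (X i ω).ofLp ≤ m) (s : Finset κ) (τ : ℝ) (k : ℕ)
    (p q : Fin n) :
    MemLp (fun ω => ((1 + τ • gram (fun i => X i ω) s) ^ k) p q) ⊤ μ := by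
  refine memLp_top_matrix_pow (M := fun ω => 1 + τ • gram (fun i => X i ω) s) (fun p q => ?_) k p q
  simp only [gram, Matrix.add_apply, Matrix.smul_apply, Matrix.sum_apply, vecMulVec_apply]
  have h : MemLp (fun ω => ∑ i ∈ s, X i ω p * X i ω q) ⊤ μ :=
    memLp_finsetSum _ fun i _ => (memLp_top_coord hX hb i q).mul' (memLp_top_coord hX hb i p)
  exact (memLp_const ((1 : Matrix (Fin n) (Fin n) ℝ) p q)).add (h.const_mul τ)

theorem integrable_trace_pow [IsFiniteMeasure μ] (hX : ∀ i, Measurable (X i))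
    (hb : ∀ i, ∀ᵐ ω ∂μ, (X i ω).ofLp ⬝ᵥ (X i ω).ofLp ≤ m) (s : Finset κ) (τ : ℝ) (k : ℕ) :
    Integrable (fun ω => ((1 + τ • gram (fun i => X i ω) s) ^ k).trace) μ := by
  simp only [Matrix.trace, Matrix.diag]
  exact integrable_finsetSum _ fun p _ =>
    (memLp_top_pow_one_add_gram hX hb s τ k p p).integrable le_top

theorem integrable_dotProduct_pow [IsFiniteMeasure μ] (hX : ∀ i, Measurable (X i))
    (hb : ∀ i, ∀ᵐ ω ∂μ, (X i ω).ofLp ⬝ᵥ (X i ω).ofLp ≤ m) (s : Finset κ) (i : κ) (τ : ℝ)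
    (k : ℕ) :
    Integrable (fun ω => (X i ω).ofLp ⬝ᵥ
      ((1 + τ • gram (fun i => X i ω) s) ^ k *ᵥ (X i ω).ofLp)) μ := by
  simp only [dotProduct, mulVec]
  have h : ∀ p, MemLp (fun ω => ∑ q, ((1 + τ • gram (fun i => X i ω) s) ^ k) p q * X i ω q) ⊤ μ :=
    fun p => memLp_finsetSum _ fun q _ =>
      (memLp_top_coord hX hb i q).mul' (memLp_top_pow_one_add_gram hX hb s τ k p q)
  exact integrable_finsetSum _ fun p _ =>
    ((h p).mul' (r := ⊤) (memLp_top_coord hX hb i p)).integrable le_top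

/-- The expectation over an independent isotropic vector turns a quadratic form into a trace. -/
theorem integral_dotProduct_pow [IsProbabilityMeasure μ] (hX : ∀ i, Measurable (X i))
    (hind : iIndepFun X μ) (hiso : ∀ i, IsIsotropic (X i) μ)
    (hb : ∀ i, ∀ᵐ ω ∂μ, (X i ω).ofLp ⬝ᵥ (X i ω).ofLp ≤ m) {s : Finset κ} {i : κ} (hi : i ∉ s)
    (τ : ℝ) (k : ℕ) :
    ∫ ω, (X i ω).ofLp ⬝ᵥ ((1 + τ • gram (fun i => X i ω) s) ^ k *ᵥ (X i ω).ofLp) ∂μ =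
      ∫ ω, ((1 + τ • gram (fun i => X i ω) s) ^ k).trace ∂μ := by
  have hindep : ∀ p q, IndepFun (fun ω => ((1 + τ • gram (fun i => X i ω) s) ^ k) p q)
      (fun ω => X i ω p * X i ω q) μ := by
    intro p q
    -- The power depends only on the rows in `s`, and `i ∉ s`.
    have h := hind.indepFun_finset s {i} (Finset.disjoint_singleton_right.2 hi) hX
    have h2 := h.comp (continuous_pow_one_add_gram (κ := s) τ k p q).measurable
      (ψ := fun y : ({i} : Finset κ) → EuclideanSpace ℝ (Fin n) =>
        y ⟨i, Finset.mem_singleton_self i⟩ p * y ⟨i, Finset.mem_singleton_self i⟩ q)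
      (by fun_prop)
    refine h2.congr (.of_forall fun ω => ?_) (.of_forall fun ω => rfl)
    have : gram (fun i => X i ω) s = gram (fun j : s => X j ω) Finset.univ := by
      rw [gram, gram, ← Finset.sum_coe_sort s]
    simp [this]
  have hM := memLp_top_pow_one_add_gram hX hb s τ k
  have hXm := memLp_top_coord hX hb i
  have hXX : ∀ p q, MemLp (fun ω => X i ω p * X i ω q) ⊤ μ := fun p q => (hXm q).mul' (hXm p)
  have e : ∀ ω, (X i ω).ofLp ⬝ᵥ ((1 + τ • gram (fun i => X i ω) s) ^ k *ᵥ (X i ω).ofLp) =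
      ∑ p, ∑ q, ((1 + τ • gram (fun i => X i ω) s) ^ k) p q * (X i ω p * X i ω q) := by
    intro ω
    simp only [dotProduct, mulVec, Finset.mul_sum]
    exact Finset.sum_congr rfl fun p _ => Finset.sum_congr rfl fun q _ => by ring
  simp only [e, Matrix.trace, Matrix.diag]
  rw [integral_finsetSum _ fun p _ => integrable_finsetSum _ fun q _ =>
      ((hXX p q).mul' (hM p q)).integrable le_top,
    integral_finsetSum _ fun p _ => (hM p p).integrable le_top]
  refine Finset.sum_congr rfl fun p _ => ?_
  rw [integral_finsetSum _ fun q _ => ((hXX p q).mul' (hM p q)).integrable le_top]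
  have h2 : ∀ q, ∫ ω, X i ω p * X i ω q ∂μ = (1 : Matrix (Fin n) (Fin n) ℝ) p q := fun q => by
    rw [← (hiso i).2, secondMomentMatrix, Matrix.of_apply]
  have h3 : ∀ q ∈ Finset.univ, ∫ ω, ((1 + τ • gram (fun i => X i ω) s) ^ k) p q *
      (X i ω p * X i ω q) ∂μ = if p = q then
        ∫ ω, ((1 + τ • gram (fun i => X i ω) s) ^ k) p q ∂μ else 0 := by
    intro q _
    rw [(hindep p q).integral_fun_mul_eq_mul_integral (hM p q).1 (hXX p q).1, h2, Matrix.one_apply]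
    split_ifs <;> simp
  rw [Finset.sum_congr rfl h3]
  simp

/-- Induction on the rows: each new one multiplies the expected trace by at most `1 + τ ρ ≤ exp (τ
ρ)`, starting from `tr 1 = n`. -/
theorem integral_trace_pow_le [IsProbabilityMeasure μ] [DecidableEq κ]
    (hX : ∀ i, Measurable (X i))
    (hind : iIndepFun X μ) (hiso : ∀ i, IsIsotropic (X i) μ) (hm : 0 < m)
    (hb : ∀ i, ∀ᵐ ω ∂μ, (X i ω).ofLp ⬝ᵥ (X i ω).ofLp ≤ m) {τ a B : ℝ} (hτ : τ ≠ 0)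
    (ha : 0 < a) (ha1 : a ≤ 1) (haB : a ≤ 1 + τ * B) (k : ℕ) (s : Finset κ)
    (hs : s.card * m ≤ B) :
    ∫ ω, ((1 + τ • gram (fun i => X i ω) s) ^ (k + 1)).trace ∂μ ≤
      n * Real.exp (s.card *
        (τ * ((k + 1) * ((Real.exp ((k + 1) * τ * m / a) - 1) / ((k + 1) * τ * m / a))))) := by
  induction s using Finset.induction_on with
  | empty => simp [gram]
  | insert i s hi ih =>
    have hB : (s.card : ℝ) * m ≤ B := by
      rw [Finset.card_insert_of_notMem hi] at hs
      push_cast at hs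
      linarith
    specialize ih hB
    set c : ℝ := (k + 1) * τ * m / a
    set ρ : ℝ := (k + 1) * ((Real.exp c - 1) / c) with hρ
    have hρ0 : 0 ≤ ρ := by
      refine mul_nonneg (by positivity) ?_
      rcases le_total 0 c with h | h
      · exact div_nonneg (sub_nonneg.2 (Real.one_le_exp h)) h
      · exact div_nonneg_of_nonpos (sub_nonpos.2 (Real.exp_le_one_iff.2 h)) h
    have hbs : ∀ᵐ ω ∂μ, ∀ j ∈ insert i s, (X j ω).ofLp ⬝ᵥ (X j ω).ofLp ≤ m :=
      (Finset.eventually_all _).2 fun j _ => hb j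
    have hG : ∀ᵐ ω ∂μ, IsBetween (gram (fun i => X i ω) s) B ∧
        IsBetween (gram (fun i => X i ω) (insert i s)) B ∧
        (X i ω).ofLp ⬝ᵥ (X i ω).ofLp ≤ m := by
      filter_upwards [hbs] with ω h
      exact ⟨isBetween_gram (fun j hj => h j (Finset.mem_insert_of_mem hj)) hB,
        isBetween_gram h hs, h i (Finset.mem_insert_self i s)⟩
    have I1 := integrable_trace_pow hX hb s τ (k + 1)
    have I0 := integrable_trace_pow hX hb s τ k
    have Iq := integrable_dotProduct_pow hX hb s i τ k
    set T := ∫ ω, ((1 + τ • gram (fun i => X i ω) s) ^ (k + 1)).trace ∂μ with hT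
    have hT0 : 0 ≤ T := by
      refine integral_nonneg_of_ae ?_
      filter_upwards [hG] with ω h
      exact h.1.trace_pow_nonneg ha ha1 haB _
    have step1 : ∫ ω, ((1 + τ • gram (fun i => X i ω) (insert i s)) ^ (k + 1)).trace ∂μ ≤
        T + τ * ρ * ∫ ω, ((1 + τ • gram (fun i => X i ω) s) ^ k).trace ∂μ := by
      rw [← integral_dotProduct_pow hX hind hiso hb hi, ← integral_const_mul, hT,
        ← integral_add I1 (Iq.const_mul _)]
      refine integral_mono_ae (integrable_trace_pow hX hb _ τ _) (I1.add (Iq.const_mul _)) ?_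
      filter_upwards [hG] with ω h
      have h2 := h.2.1
      rw [gram_insert _ hi] at h2 ⊢
      exact trace_pow_rank_one_update_le h.1 h2 ha ha1 haB hm h.2.2 hτ k
    have step2 : τ * ρ * ∫ ω, ((1 + τ • gram (fun i => X i ω) s) ^ k).trace ∂μ ≤ τ * ρ * T := by
      -- Only `ρ` is cancelled: the comparison of the two traces holds after multiplication by `τ`,
      -- whatever its sign.
      rw [mul_comm τ ρ, mul_assoc ρ, mul_assoc ρ]
      refine mul_le_mul_of_nonneg_left ?_ hρ0
      rw [hT, ← integral_const_mul, ← integral_const_mul]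
      refine integral_mono_ae (I0.const_mul _) (I1.const_mul _) ?_
      filter_upwards [hG] with ω h
      exact h.1.mul_trace_pow_le ha ha1 haB k
    calc _ ≤ (τ * ρ + 1) * T := by linarith
      _ ≤ Real.exp (τ * ρ) * T := mul_le_mul_of_nonneg_right (Real.add_one_le_exp _) hT0
      _ ≤ Real.exp (τ * ρ) * (n * Real.exp (s.card * (τ * ρ))) :=
        mul_le_mul_of_nonneg_left ih (Real.exp_pos _).le
      _ = _ := by
        rw [Finset.card_insert_of_notMem hi, mul_left_comm, ← Real.exp_add]
        push_cast
        congr 2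
        ring

end Probability

/-! ### Singular values as Gram eigenvalues -/

open Filter Topology

theorem gram_row_univ {N n : ℕ} (A : Matrix (Fin N) (Fin n) ℝ) :
    gram (row A) Finset.univ = Aᵀ * A := by
  ext p q
  simp [gram, row, Matrix.sum_apply, vecMulVec_apply, Matrix.mul_apply]

theorem exists_gram_eigenvector {N n : ℕ} (A : Matrix (Fin N) (Fin n) ℝ) {i : ℕ} (hi : i < n) :
    ∃ x : Fin n → ℝ, x ≠ 0 ∧ gram (row A) Finset.univ *ᵥ x =
      (A.toEuclideanLin.singularValues i ^ 2) • x := by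
  obtain ⟨x, hx⟩ := (A.toEuclideanLin.hasEigenvalue_adjoint_comp_self_sq_singularValues
    (n := i) (by simpa using hi)).exists_hasEigenvector
  refine ⟨x.ofLp, fun h => hx.2 ((WithLp.ofLp_eq_zero 2).1 h), ?_⟩
  have h := hx.apply_eq_smul
  rw [← Matrix.toEuclideanLin_conjTranspose_eq_adjoint,
    conjTranspose_eq_transpose_of_trivial] at h
  rw [gram_row_univ, ← mulVec_mulVec]
  exact congrArg WithLp.ofLp h

/-- Otherwise the vector vanishes almost surely, against a unit second moment of its first
coordinate. -/
theorem IsIsotropic.pos_of_dotProduct_self_le {Ω : Type*} [MeasurableSpace Ω] {μ : Measure Ω}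
    {n : ℕ} {m : ℝ} {X : Ω → EuclideanSpace ℝ (Fin n)}
    (hiso : IsIsotropic X μ) (hn : 1 ≤ n) (hb : ∀ᵐ ω ∂μ, (X ω).ofLp ⬝ᵥ (X ω).ofLp ≤ m) :
    0 < m := by
  by_contra! hm
  have h0 : (fun ω => X ω ⟨0, hn⟩ * X ω ⟨0, hn⟩) =ᵐ[μ] fun _ => (0 : ℝ) := by
    filter_upwards [hb] with ω h
    have h1 : (X ω).ofLp ⬝ᵥ (X ω).ofLp = 0 :=
      le_antisymm (h.trans hm) (Finset.sum_nonneg fun i _ => mul_self_nonneg _)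
    rw [dotProduct_self_eq_zero.1 h1]
    simp
  have h1 := congrFun (congrFun hiso.2 ⟨0, hn⟩) ⟨0, hn⟩
  rw [secondMomentMatrix, Matrix.of_apply, integral_congr_ae h0] at h1
  simp at h1

/-! ### Tail bounds for the singular values -/

section Tail

variable {Ω : Type*} [MeasurableSpace Ω] {μ : Measure Ω} [IsProbabilityMeasure μ]
  {N n : ℕ} {A : Ω → Matrix (Fin N) (Fin n) ℝ} {m : ℝ}

/-- Markov's inequality for the trace, which dominates `(1 + τ σᵢ ²) ^ (k + 1)` for every `i < n`.
-/
theorem pow_mul_measureReal_singularValues_le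
    (hX : ∀ i, Measurable fun ω => row (A ω) i) (hind : iIndepFun (fun i ω => row (A ω) i) μ)
    (hiso : ∀ i, IsIsotropic (fun ω => row (A ω) i) μ) (hm : 0 < m)
    (hb : ∀ i, ∀ᵐ ω ∂μ, (row (A ω) i).ofLp ⬝ᵥ (row (A ω) i).ofLp ≤ m) {τ a L : ℝ} (hτ : τ ≠ 0)
    (ha : 0 < a) (ha1 : a ≤ 1) (haB : a ≤ 1 + τ * (N * m)) (k : ℕ) (hL : 0 ≤ 1 + τ * L) :
    (1 + τ * L) ^ (k + 1) * μ.real {ω | ∃ i < n,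
        τ * L ≤ τ * (A ω).toEuclideanLin.singularValues i ^ 2} ≤
      n * Real.exp (N *
        (τ * ((k + 1) * ((Real.exp ((k + 1) * τ * m / a) - 1) / ((k + 1) * τ * m / a))))) := by
  have hcard : ((Finset.univ : Finset (Fin N)).card : ℝ) * m ≤ N * m := by simp
  have key := integral_trace_pow_le hX hind hiso hm hb hτ ha ha1 haB k Finset.univ hcard
  rw [Finset.card_univ, Fintype.card_fin] at key
  refine le_trans ?_ key
  have hG : ∀ᵐ ω ∂μ, IsBetween (gram (row (A ω)) Finset.univ) (N * m) := by
    filter_upwards [ae_all_iff.2 hb] with ω h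
    exact isBetween_gram (fun i _ => h i) hcard
  refine le_trans ?_ (mul_meas_ge_le_integral_of_nonneg ?_
    (integrable_trace_pow hX hb Finset.univ τ (k + 1)) ((1 + τ * L) ^ (k + 1)))
  · refine mul_le_mul_of_nonneg_left ?_ (pow_nonneg hL _)
    refine ENNReal.toReal_mono (measure_ne_top _ _) (measure_mono_ae ?_)
    filter_upwards [hG] with ω h hω
    obtain ⟨i, hi, hLi⟩ := hω
    obtain ⟨x, hx, hxe⟩ := exists_gram_eigenvector (A ω) hi
    exact (pow_le_pow_left₀ hL (by linarith) _).trans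
      (h.pow_le_trace_pow ha ha1 haB (k + 1) hx hxe)
  · filter_upwards [hG] with ω h
    exact h.trace_pow_nonneg ha ha1 haB _

/-- A Laplace transform bound for the singular values: the upper tail for `θ > 0`, the lower tail
for `θ < 0`. -/
theorem measureReal_singularValues_le_exp
    (hX : ∀ i, Measurable fun ω => row (A ω) i) (hind : iIndepFun (fun i ω => row (A ω) i) μ)
    (hiso : ∀ i, IsIsotropic (fun ω => row (A ω) i) μ) (hm : 0 < m)
    (hb : ∀ i, ∀ᵐ ω ∂μ, (row (A ω) i).ofLp ⬝ᵥ (row (A ω) i).ofLp ≤ m) {θ : ℝ} (hθ : θ ≠ 0)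
    (L : ℝ) :
    μ.real {ω | ∃ i < n, θ * L ≤ θ * (A ω).toEuclideanLin.singularValues i ^ 2} ≤
      n * Real.exp (N * (Real.exp (θ * m) - 1) / m - θ * L) := by
  set P := μ.real {ω | ∃ i < n, θ * L ≤ θ * (A ω).toEuclideanLin.singularValues i ^ 2} with hP
  have hτ0 : Tendsto (fun k : ℕ => θ / ((k : ℝ) + 1)) atTop (𝓝 0) := by
    simpa [Function.comp_def] using
      (tendsto_const_div_atTop_nhds_zero_nat θ).comp (tendsto_add_atTop_nat 1)
  have h1 : ∀ b : ℝ, Tendsto (fun k : ℕ => 1 + θ / ((k : ℝ) + 1) * b) atTop (𝓝 1) := fun b => by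
    simpa using (hτ0.mul_const b).const_add 1
  -- This minimum plays the role of `a`: it is an admissible floor once positive, and it costs
  -- nothing in the limit.
  have ha : Tendsto (fun k : ℕ => min 1 (1 + θ / ((k : ℝ) + 1) * (N * m))) atTop (𝓝 1) := by
    simpa using (tendsto_const_nhds (x := (1 : ℝ))).min (h1 (N * m))
  have hleft : Tendsto (fun k : ℕ => (1 + θ / ((k : ℝ) + 1) * L) ^ (k + 1) * P) atTop
      (𝓝 (Real.exp (θ * L) * P)) := by
    refine Tendsto.mul_const P ?_
    refine ((Real.tendsto_one_add_div_pow_exp (θ * L)).comp (tendsto_add_atTop_nat 1)).congr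
      fun k => ?_
    simp [div_mul_eq_mul_div]
  have hright : Tendsto (fun k : ℕ => (n : ℝ) * Real.exp (N * (θ * ((Real.exp (θ * m /
      min 1 (1 + θ / ((k : ℝ) + 1) * (N * m))) - 1) /
        (θ * m / min 1 (1 + θ / ((k : ℝ) + 1) * (N * m))))))) atTop
      (𝓝 (n * Real.exp (N * (θ * ((Real.exp (θ * m / 1) - 1) / (θ * m / 1)))))) := by
    have hd := (tendsto_const_nhds (x := θ * m)).div ha one_ne_zero
    have hne : θ * m / 1 ≠ 0 := by
      rw [div_one]; exact mul_ne_zero hθ hm.ne'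
    refine Tendsto.const_mul _ (Tendsto.rexp (Tendsto.const_mul _ (Tendsto.const_mul _ ?_)))
    exact (hd.rexp.sub_const 1).div hd hne
  have hlim := le_of_tendsto_of_tendsto hleft hright ?_
  · have e : (N : ℝ) * (θ * ((Real.exp (θ * m / 1) - 1) / (θ * m / 1))) =
        N * (Real.exp (θ * m) - 1) / m := by
      have := hm.ne'
      rw [div_one]
      field_simp
    rw [e, mul_comm, ← le_div_iff₀ (Real.exp_pos _), mul_div_assoc, ← Real.exp_sub] at hlim
    exact hlim
  · filter_upwards [ha.eventually (lt_mem_nhds one_pos), (h1 L).eventually (lt_mem_nhds one_pos)]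
      with k hk1 hk2
    have hk : (0 : ℝ) < k + 1 := by positivity
    have key := pow_mul_measureReal_singularValues_le hX hind hiso hm hb (div_ne_zero hθ hk.ne')
      hk1 (min_le_left _ _) (min_le_right _ _) k hk2.le
    have e1 : ((k : ℝ) + 1) * (θ / (k + 1)) = θ := mul_div_cancel₀ θ hk.ne'
    have e2 : ∀ z : ℝ, θ / ((k : ℝ) + 1) * ((k + 1) * z) = θ * z := fun z => by
      rw [← mul_assoc, mul_comm (θ / _), e1]
    rw [e1, e2] at key
    have e3 : ∀ x y, θ / ((k : ℝ) + 1) * x ≤ θ / ((k : ℝ) + 1) * y ↔ θ * x ≤ θ * y := fun x y => by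
      rw [div_mul_eq_mul_div, div_mul_eq_mul_div, div_le_div_iff_of_pos_right hk]
    simp only [e3] at key
    exact key

/-- The choice `θ = 2 log r / m` minimises the exponent at `L = N r ²`, since then `exp (θ m) = r
²`. The sign of `log r` picks the tail. -/
theorem measureReal_log_mul_singularValues_le
    (hX : ∀ i, Measurable fun ω => row (A ω) i) (hind : iIndepFun (fun i ω => row (A ω) i) μ)
    (hiso : ∀ i, IsIsotropic (fun ω => row (A ω) i) μ) (hm : 0 < m)
    (hb : ∀ i, ∀ᵐ ω ∂μ, (row (A ω) i).ofLp ⬝ᵥ (row (A ω) i).ofLp ≤ m) {r : ℝ} (hr : 0 < r)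
    (hr1 : r ≠ 1) :
    μ.real {ω | ∃ i < n, Real.log r * (N * r ^ 2) ≤
        Real.log r * (A ω).toEuclideanLin.singularValues i ^ 2} ≤
      n * Real.exp (-(N * (r - 1) ^ 2 / m)) := by
  have hlog : Real.log r ≠ 0 := Real.log_ne_zero_of_pos_of_ne_one hr hr1
  have hc : 0 < 2 / m := by positivity
  have key := measureReal_singularValues_le_exp hX hind hiso hm hb
    (mul_ne_zero hc.ne' hlog) (N * r ^ 2)
  have hset : ∀ x y : ℝ, 2 / m * Real.log r * x ≤ 2 / m * Real.log r * y ↔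
      Real.log r * x ≤ Real.log r * y := fun x y => by
    rw [mul_assoc, mul_assoc, mul_le_mul_iff_right₀ hc]
  simp only [hset] at key
  refine key.trans (mul_le_mul_of_nonneg_left (Real.exp_le_exp.2 ?_) n.cast_nonneg)
  have e1 : Real.exp (2 / m * Real.log r * m) = r ^ 2 := by
    have : 2 / m * Real.log r * m = Real.log r + Real.log r := by
      have := hm.ne'
      field_simp
      ring
    rw [this, Real.exp_add, Real.exp_log hr, sq]
  -- From `log r ≥ 1 - 1 / r`; it turns `r ² - 1 - 2 r ² log r` into at most `-(r - 1) ²`.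
  have h2 : r ^ 2 - r ≤ r ^ 2 * Real.log r := by
    have h3 := mul_le_mul_of_nonneg_left (Real.one_sub_inv_le_log_of_pos hr) (sq_nonneg r)
    have : r ^ 2 * (1 - r⁻¹) = r ^ 2 - r := by
      have := hr.ne'
      field_simp
    linarith
  have e2 : (N : ℝ) * (r ^ 2 - 1) / m - 2 / m * Real.log r * (N * r ^ 2) =
      N / m * (r ^ 2 - 1 - 2 * (r ^ 2 * Real.log r)) := by ring
  have e3 : -((N : ℝ) * (r - 1) ^ 2 / m) = N / m * -(r - 1) ^ 2 := by ring
  rw [e1, e2, e3]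
  exact mul_le_mul_of_nonneg_left (by nlinarith) (by positivity)

end Tail

end RandomMatrix

/-! ### The two-sided bound -/

theorem mainTheorem2 :
    ∃ c : ℝ, 0 < c ∧
      ∀ {Ω : Type*} [MeasurableSpace Ω] (μ : Measure Ω) [IsProbabilityMeasure μ]
        (N n : ℕ) (_hn : 1 ≤ n) (A : Ω → Matrix (Fin N) (Fin n) ℝ)
        (_hmeas : ∀ i, Measurable fun ω => RandomMatrix.row (A ω) i)
        (_hindep : iIndepFun (fun i ω => RandomMatrix.row (A ω) i) μ)
        (_hiso : ∀ i, RandomMatrix.IsIsotropic (fun ω => RandomMatrix.row (A ω) i) μ)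
        (m : ℝ) (_hbound : ∀ i, ∀ᵐ ω ∂μ, ‖RandomMatrix.row (A ω) i‖ ≤ √m)
        (t : ℝ) (_ht : 0 ≤ t),
        1 - 2 * (n : ℝ) * Real.exp (-c * t ^ 2) ≤
          μ.real {ω | √(N : ℝ) - t * √m ≤ RandomMatrix.sMin (A ω) ∧
            RandomMatrix.sMin (A ω) ≤ RandomMatrix.sMax (A ω) ∧
            RandomMatrix.sMax (A ω) ≤ √(N : ℝ) + t * √m} := by
  refine ⟨1, one_pos, ?_⟩
  intro Ω _ μ _ N n hn A hX hind hiso m hbound t ht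
  have hn' : (1 : ℝ) ≤ n := by exact_mod_cast hn
  have hmin : ∀ ω, 0 ≤ RandomMatrix.sMin (A ω) := fun ω => LinearMap.singularValues_nonneg _ _
  have hmax : ∀ ω, 0 ≤ RandomMatrix.sMax (A ω) := fun ω => LinearMap.singularValues_nonneg _ _
  have hle : ∀ ω, RandomMatrix.sMin (A ω) ≤ RandomMatrix.sMax (A ω) := fun ω =>
    LinearMap.singularValues_antitone _ (Nat.zero_le _)
  rcases ht.eq_or_lt with rfl | ht
  -- At `t = 0` one would need `r = 1`, which is excluded; but `1 - 2 n ≤ 0`.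
  · refine le_trans ?_ measureReal_nonneg
    simp
    linarith
  rcases Nat.eq_zero_or_pos N with rfl | hN
  · have h0 : ∀ ω, RandomMatrix.sMin (A ω) = 0 ∧ RandomMatrix.sMax (A ω) = 0 := fun ω => by
      have : (A ω).toEuclideanLin = 0 := Subsingleton.elim _ _
      simp [RandomMatrix.sMin, RandomMatrix.sMax, this]
    have hs : 0 ≤ t * √m := by positivity
    simp only [(h0 _).1, (h0 _).2, Nat.cast_zero, Real.sqrt_zero, zero_sub, neg_nonpos, hs,
      zero_add, le_refl, and_self, Set.ofPred_true, probReal_univ]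
    have : 0 ≤ 2 * (n : ℝ) * Real.exp (-1 * t ^ 2) := by positivity
    linarith
  -- A negative `m` is not excluded a priori, and then `√m = 0`; isotropy of a row rules it out
  -- below.
  have hb : ∀ i, ∀ᵐ ω ∂μ, (RandomMatrix.row (A ω) i).ofLp ⬝ᵥ (RandomMatrix.row (A ω) i).ofLp ≤
      max m 0 := by
    intro i
    filter_upwards [hbound i] with ω h
    rw [RandomMatrix.dotProduct_self_eq_norm_sq]
    calc _ ≤ √m ^ 2 := pow_le_pow_left₀ (norm_nonneg _) h 2
      _ = max m 0 := Real.sq_sqrt'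
  have hm : 0 < m := by
    have := (hiso ⟨0, hN⟩).pos_of_dotProduct_self_le hn (hb ⟨0, hN⟩)
    simpa using this
  rw [max_eq_left hm.le] at hb
  have hsN : 0 < √(N : ℝ) := Real.sqrt_pos.2 (by exact_mod_cast hN)
  have hsm : 0 < √m := Real.sqrt_pos.2 hm
  have hNs : (N : ℝ) = √(N : ℝ) ^ 2 := (Real.sq_sqrt N.cast_nonneg).symm
  -- With this `u`, `√N (1 ± u) = √N ± t √m` and the exponent `N u ² / m` is `t ²`.
  obtain ⟨u, hu⟩ : ∃ u, u = t * √m / √(N : ℝ) := ⟨_, rfl⟩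
  have hu0 : 0 < u := by rw [hu]; positivity
  have hut : √(N : ℝ) * u = t * √m := by
    rw [hu]
    field_simp
  have hexp : (N : ℝ) * u ^ 2 / m = t ^ 2 := by
    rw [hNs, ← mul_pow, hut, mul_pow, Real.sq_sqrt hm.le]
    field_simp
  have hU : μ.real {ω | √(N : ℝ) + t * √m < RandomMatrix.sMax (A ω)} ≤
      n * Real.exp (-1 * t ^ 2) := by
    have h := RandomMatrix.measureReal_log_mul_singularValues_le hX hind hiso hm hb
      (r := 1 + u) (by linarith) (by linarith)
    rw [add_sub_cancel_left, hexp] at h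
    rw [neg_one_mul]
    refine (measureReal_mono ?_).trans h
    intro ω hω
    refine ⟨0, hn, mul_le_mul_of_nonneg_left ?_ (Real.log_nonneg (by linarith))⟩
    rw [hNs, ← mul_pow, mul_add, mul_one, hut]
    exact pow_le_pow_left₀ (by positivity) (le_of_lt hω) 2
  have hL : μ.real {ω | RandomMatrix.sMin (A ω) < √(N : ℝ) - t * √m} ≤
      n * Real.exp (-1 * t ^ 2) := by
    -- For `u ≥ 1` the radius `1 - u` is not positive, but the threshold is at most `0` and the
    -- event is empty.
    rcases le_or_gt 1 u with h1 | h1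
    · have : {ω | RandomMatrix.sMin (A ω) < √(N : ℝ) - t * √m} = ∅ := by
        refine Set.eq_empty_iff_forall_notMem.2 fun ω hω => ?_
        have h2 : RandomMatrix.sMin (A ω) < √(N : ℝ) - t * √m := hω
        nlinarith [hmin ω]
      rw [this, measureReal_empty]
      positivity
    have h := RandomMatrix.measureReal_log_mul_singularValues_le hX hind hiso hm hb
      (r := 1 - u) (by linarith) (by linarith)
    rw [sub_sub_cancel_left, neg_sq, hexp] at h
    rw [neg_one_mul]
    refine (measureReal_mono ?_).trans h
    intro ω hω
    refine ⟨n - 1, Nat.sub_lt hn one_pos,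
      mul_le_mul_of_nonpos_left ?_ (Real.log_nonpos (by linarith) (by linarith))⟩
    rw [hNs, ← mul_pow, mul_sub, mul_one, hut]
    exact pow_le_pow_left₀ (hmin ω) (le_of_lt hω) 2
  set S := {ω | √(N : ℝ) - t * √m ≤ RandomMatrix.sMin (A ω) ∧
    RandomMatrix.sMin (A ω) ≤ RandomMatrix.sMax (A ω) ∧
    RandomMatrix.sMax (A ω) ≤ √(N : ℝ) + t * √m}
  have hcover : (Set.univ : Set Ω) ⊆ S ∪ {ω | √(N : ℝ) + t * √m < RandomMatrix.sMax (A ω)} ∪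
      {ω | RandomMatrix.sMin (A ω) < √(N : ℝ) - t * √m} := by
    intro ω _
    by_cases h1 : RandomMatrix.sMin (A ω) < √(N : ℝ) - t * √m
    · exact Or.inr h1
    by_cases h2 : √(N : ℝ) + t * √m < RandomMatrix.sMax (A ω)
    · exact Or.inl (Or.inr h2)
    · exact Or.inl (Or.inl ⟨not_lt.1 h1, hle ω, not_lt.1 h2⟩)
  have h1 : (1 : ℝ) ≤ _ := (probReal_univ (μ := μ)).symm.le.trans (measureReal_mono hcover)
  have h2 := measureReal_union_le (μ := μ)
    (S ∪ {ω | √(N : ℝ) + t * √m < RandomMatrix.sMax (A ω)})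
    {ω | RandomMatrix.sMin (A ω) < √(N : ℝ) - t * √m}
  have h3 := measureReal_union_le (μ := μ) S {ω | √(N : ℝ) + t * √m < RandomMatrix.sMax (A ω)}
  linarith
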